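/- **Lemma 3.2 (minors).** Let $k$ be a field, let $U,V,W$ be finite-dimensional $k$-vector spaces, and let $\mu: W\otimes_k U\to V$ be a $k$-linear map (a pairing). Assume that $\mu$ is geometrically $1$-generic: writing $\bar k$ for the algebraic closure of $k$, the induced pairing $\mu_{\bar k}: (\bar k\otimes_k W)\otimes_{\bar k}(\bar k\otimes_k U)\to \bar k\otimes_k V$ satisfies $\mu_{\bar k}(a\otimes b)\neq 0$ for all nonzero $a\in \bar k\otimes_k W$ and $b\in\bar k\otimes_k U$. Let $d$ be an integer with $0\le d\leq \dim_k W$. Let $$\bar\mu:\; W\otimes_k \mathrm{Sym}(U^*)\to V\otimes_k \mathrm{Sym}(U^*)(1)$$ be the associated map of free $\mathrm{Sym}(U^*)$-modules, that is, the $\mathrm{Sym}(U^*)$-linear map whose restriction to $W$ is the map $W\to \mathrm{Hom}_k(U,V)= V\otimes_k U^*$, $w\mapsto \mu(w\otimes -)$. Then the $d\times d$ minors of the matrix of $\bar\mu$ with respect to any bases of $W$ and $V$ span, over $k$, the homogeneous component $\mathrm{Sym}_d(U^*)$ of degree $d$ of $\mathrm{Sym}(U^*)$. -/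

import Mathlib

open scoped TensorProduct

noncomputable section

namespace Pairing

/-- A pairing `μ : W ⊗ U → V` is `1`-generic if `μ (a ⊗ b) ≠ 0` for all nonzero `a ∈ W`, `b ∈ U`. -/
def IsOneGeneric {K W U V : Type*} [Field K] [AddCommGroup W] [Module K W]
    [AddCommGroup U] [Module K U] [AddCommGroup V] [Module K V]
    (μ : W ⊗[K] U →ₗ[K] V) : Prop :=
  ∀ (a : W) (b : U), a ≠ 0 → b ≠ 0 → μ (a ⊗ₜ[K] b) ≠ 0

/-- The pairing `(L ⊗ W) ⊗_L (L ⊗ U) → L ⊗ V` induced by `μ : W ⊗ U → V` over an extension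
field `L`. -/
def extendScalars {k W U V : Type*} (L : Type*) [Field k] [Field L] [Algebra k L]
    [AddCommGroup W] [Module k W] [AddCommGroup U] [Module k U] [AddCommGroup V] [Module k V]
    (μ : W ⊗[k] U →ₗ[k] V) : (L ⊗[k] W) ⊗[L] (L ⊗[k] U) →ₗ[L] L ⊗[k] V :=
  μ.baseChange L ∘ₗ (TensorProduct.AlgebraTensorModule.distribBaseChange k L W U).symm.toLinearMap

/-- A pairing is geometrically `1`-generic if it is `1`-generic over the algebraic closure. -/
def IsGeometricallyOneGeneric {k W U V : Type*} [Field k] [AddCommGroup W] [Module k W]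
    [AddCommGroup U] [Module k U] [AddCommGroup V] [Module k V]
    (μ : W ⊗[k] U →ₗ[k] V) : Prop :=
  IsOneGeneric (extendScalars (AlgebraicClosure k) μ)

/-- `Sym(U^*)`. -/
abbrev SymDual (k U : Type*) [Field k] [AddCommGroup U] [Module k U] :=
  SymmetricAlgebra k (Module.Dual k U)

/-- The homogeneous component `Sym_d(U^*)` of `Sym(U^*)`: the span of all `d`-fold products of
elements of `U^*`. -/
def symDualPiece (k U : Type*) [Field k] [AddCommGroup U] [Module k U] (d : ℕ) :
    Submodule k (SymDual k U) :=
  LinearMap.range (SymmetricAlgebra.ι k (Module.Dual k U)) ^ d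

/-- The `Sym(U^*)`-linear map `Sym(U^*) ⊗ W → Sym(U^*) ⊗ V` associated to `μ : W ⊗ U → V`. It is
the extension of scalars of the map `W → Hom(U, V) = U^* ⊗ V ⊆ Sym(U^*) ⊗ V` adjoint to `μ`. Its
values on `W` are linear in `U^*`, so it has degree zero as a map to `Sym(U^*)(1) ⊗ V`. -/
def associatedMap {k W U V : Type*} [Field k] [AddCommGroup W] [Module k W]
    [AddCommGroup U] [Module k U] [FiniteDimensional k U] [AddCommGroup V] [Module k V]
    (μ : W ⊗[k] U →ₗ[k] V) : SymDual k U ⊗[k] W →ₗ[SymDual k U] SymDual k U ⊗[k] V :=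
  LinearMap.liftBaseChange (SymDual k U)
    ((SymmetricAlgebra.ι k (Module.Dual k U)).rTensor V ∘ₗ
      (dualTensorHomEquiv k U V).symm.toLinearMap ∘ₗ TensorProduct.curry μ)

/-- The `d × d` minors of a matrix: the determinants of its submatrices on `d` distinct rows and
`d` distinct columns (the rows and columns may be listed in any order, which only affects signs). -/
def minors {R m n : Type*} [CommRing R] (M : Matrix m n R) (d : ℕ) : Set R :=
  {x | ∃ (r : Fin d ↪ m) (c : Fin d ↪ n), x = (M.submatrix r c).det}

end Pairing

end

open scoped TensorProduct

noncomputable section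

/-! Fix `d` basis vectors of `W`; the minors on these `d` columns already suffice. A functional that
separates a form from the span of the minors extends to the algebraic closure, so the field may be
taken algebraically closed. Write `u = dim U` and `v = dim V`.

Next comes a reduction to `v + 1 = d + u`. If `v ≥ d + u`, the image of the bilinear map satisfies a
nontrivial polynomial relation, so some `p` lies outside it. Then `V` may be replaced by `V / ⟨p⟩`,
whose minors are among those of `V`. If `v + 1 < d + u`, zero coordinates are added.

In the critical case there are `(u + d - 1).choose d` maximal minors, an upper bound for the
dimension of the space of forms of degree `d`, so linear independence is enough
(`linearIndependent_maximal_minors`). A relation with constant coefficients is an alternating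
`d`-form `γ` on `A ^ v`, where `A` is the polynomial ring, that vanishes on the columns of the
matrix. By 1-genericity and the Nullstellensatz, powers of all `u` variables lie in the ideal for
which Cramer's rule applies. They form a regular sequence of length `u = v - d + 1`, long enough for
the de Rham–Saito division lemma (`mem_productImage_sup`): `γ` is a sum of contractions of higher
forms with the columns. The columns have linear entries, so the constant coefficients of `γ` vanish.
-/

/-- A family of elements of a ring which behave like vectors in an exterior algebra. -/
structure IsExteriorFamily {R ι : Type*} [Ring R] (T : ι → R) : Prop where
  sq_zero : ∀ i, T i * T i = 0
  anticomm : ∀ i j, T i * T j = -(T j * T i)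

/-! ### Anticommuting operators of square zero and the division lemma -/

namespace IsExteriorFamily

section Ring

variable {R ι : Type*} [Ring R] {T : ι → R}

theorem prod_map_perm (hT : IsExteriorFamily T) {l l' : List ι} (h : l.Perm l') :
    (l.map T).prod = (l'.map T).prod ∨ (l.map T).prod = -(l'.map T).prod := by
  induction h with
  | nil => simp
  | cons a _ ih =>
    rcases ih with ih | ih <;> simp [ih]
  | swap a b l =>
    right
    simp only [List.map_cons, List.prod_cons, ← mul_assoc, hT.anticomm b a, neg_mul]
  | trans _ _ ih₁ ih₂ =>
    rcases ih₁ with h₁ | h₁ <;> rcases ih₂ with h₂ | h₂ <;> simp [h₁, h₂]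

theorem prod_map_eq_zero (hT : IsExteriorFamily T) {l : List ι} (h : ¬ l.Nodup) :
    (l.map T).prod = 0 := by
  obtain ⟨a, ha⟩ := List.exists_duplicate_iff_not_nodup.mpr h
  have hs : [a, a].Sublist l := List.duplicate_iff_sublist.mp ha
  obtain ⟨l', hl'⟩ := hs.exists_perm_append
  rcases hT.prod_map_perm hl' with h | h <;>
    simp [h, ← mul_assoc, hT.sq_zero]

end Ring

variable {A L ι : Type*} [CommRing A] [AddCommGroup L] [Module A L]
  {T : ι → Module.End A L} {F : ℕ → Submodule A L}

theorem prod_map_mem_of_perm (hT : IsExteriorFamily T) {l l' : List ι} (h : l.Perm l')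
    {J : Submodule A L} {x : L} (hx : (l.map T).prod x ∈ J) : (l'.map T).prod x ∈ J := by
  rcases hT.prod_map_perm h.symm with h | h <;> simpa [h] using hx

theorem prod_map_mem_filtration (hTF : ∀ i p x, x ∈ F (p + 1) → T i x ∈ F p) (l : List ι) :
    ∀ (p : ℕ) (x : L), x ∈ F (p + l.length) → (l.map T).prod x ∈ F p := by
  induction l with
  | nil => intro p x hx; simpa using hx
  | cons i l ih =>
    intro p x hx
    simp only [List.map_cons, List.prod_cons, Module.End.mul_apply]
    refine hTF i p _ (ih (p + 1) x ?_)
    rwa [List.length_cons, Nat.add_comm l.length, ← Nat.add_assoc] at hx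

theorem prod_map_mem_of_invariant {J : Submodule A L} (hTJ : ∀ i x, x ∈ J → T i x ∈ J)
    (l : List ι) {x : L} (hx : x ∈ J) : (l.map T).prod x ∈ J := by
  induction l with
  | nil => simpa using hx
  | cons i l ih => simpa using hTJ i _ ih

/-- Cramer's rule: operators `D i` which are dual to the `T i` up to a scalar `δ` provide a
homotopy which divides a power of `δ` times a cycle by the `T i`. -/
theorem exists_pow_smul_sub_sum_mem [DecidableEq ι] (hT : IsExteriorFamily T) (hF0 : F 0 = ⊤)
    (hF : Antitone F)
    (hTF : ∀ i p x, x ∈ F (p + 1) → T i x ∈ F p)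
    (D : ι → Module.End A L) (δ : A)
    (hD : ∀ i j x, D i (T j x) + T j (D i x) = if i = j then δ • x else 0)
    (hDF : ∀ i p x, x ∈ F p → D i x ∈ F (p + 1))
    (J : Submodule A L) (hDJ : ∀ i x, x ∈ J → D i x ∈ J) (l : List ι) (hl : l.Nodup) :
    ∀ (p : ℕ) (x : L), x ∈ F p → (l.map T).prod x ∈ J →
      ∃ g : ι → L, (∀ i, g i ∈ F (p + 1)) ∧
        δ ^ l.length • x - ∑ i ∈ l.toFinset, T i (g i) ∈ J := by
  induction l with
  | nil => intro p x _ hx; exact ⟨0, fun i => zero_mem _, by simpa using hx⟩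
  | cons i l ih =>
    intro p x hxF hx
    have hil : i ∉ l := (List.nodup_cons.mp hl).1
    have hx' : (l.map T).prod (T i x) ∈ J := by
      have hp : (i :: l).Perm (l ++ [i]) := by
        simpa using (List.perm_append_comm : ([i] ++ l).Perm (l ++ [i]))
      simpa using hT.prod_map_mem_of_perm hp hx
    -- At `p = 0` the subtraction truncates, which is harmless because `F 0 = ⊤`.
    have hTx : T i x ∈ F (p - 1) := by
      rcases Nat.eq_zero_or_pos p with rfl | hp
      · simp [hF0]
      · exact hTF i _ _ (by rwa [Nat.sub_add_cancel hp])
    obtain ⟨g, hgF, hg⟩ := ih (List.nodup_cons.mp hl).2 (p - 1) (T i x) hTx hx'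
    -- The witnesses come from applying `D i` to the relation for `T i x`: `D i (T i x)` yields `δ •
    -- x - T i (D i x)`, and `D i` anticommutes with the other `T j`.
    refine ⟨fun j => if j = i then δ ^ l.length • D i x else -D i (g j), fun j => ?_, ?_⟩
    · dsimp only
      split_ifs
      · exact Submodule.smul_mem _ _ (hDF i p x hxF)
      · exact Submodule.neg_mem _ (hF (show p + 1 ≤ p - 1 + 1 + 1 by omega) (hDF i _ _ (hgF j)))
    · have h := hDJ i _ hg
      have hi : D i (T i x) = δ • x - T i (D i x) := by
        rw [eq_sub_iff_add_eq, hD, if_pos rfl]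
      have hs : ∑ j ∈ l.toFinset, D i (T j (g j)) =
          ∑ j ∈ l.toFinset, T j (if j = i then δ ^ l.length • D i x else -D i (g j)) := by
        refine Finset.sum_congr rfl fun j hj => ?_
        have hji : j ≠ i := by rintro rfl; exact hil (by simpa using hj)
        rw [if_neg hji, map_neg, eq_neg_iff_add_eq_zero, hD, if_neg hji.symm]
      rw [map_sub, map_smul, map_sum, hi, hs] at h
      dsimp only
      rw [List.toFinset_cons, Finset.sum_insert (by simpa using hil), if_pos rfl,
        List.length_cons, map_smul, pow_succ, mul_smul, ← sub_sub, ← smul_sub]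
      exact h

variable [Fintype ι]

variable (T F) in
/-- The submodule of sums of `m`-fold products of the `T i` applied to the `(p + m)`-th step of the
filtration. -/
noncomputable def productImage (m p : ℕ) : Submodule A L :=
  ⨆ S ∈ Finset.powersetCard m (Finset.univ : Finset ι),
    (F (p + m)).map (S.toList.map T).prod

/-- Reordering a product costs only a sign and a repeated index kills it, so the enumeration of
subsets in `productImage` is immaterial. -/
theorem prod_map_mem_productImage (hT : IsExteriorFamily T) {m p : ℕ} {l : List ι}
    (hl : l.length = m) {x : L} (hx : x ∈ F (p + m)) :
    (l.map T).prod x ∈ productImage T F m p := by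
  classical
  by_cases hn : l.Nodup
  · have hp : l.toFinset.toList.Perm l := List.toFinset_toList hn
    have hc : l.toFinset ∈ Finset.powersetCard m (Finset.univ : Finset ι) := by
      simp [Finset.mem_powersetCard, List.toFinset_card_of_nodup hn, hl]
    refine hT.prod_map_mem_of_perm hp ?_
    exact Submodule.mem_iSup_of_mem _ (Submodule.mem_iSup_of_mem hc ⟨x, hx, rfl⟩)
  · simp [hT.prod_map_eq_zero hn]

theorem productImage_le {m p : ℕ} {Q : Submodule A L}
    (h : ∀ l : List ι, l.length = m → ∀ x ∈ F (p + m), (l.map T).prod x ∈ Q) :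
    productImage T F m p ≤ Q := by
  refine iSup₂_le fun S hS => ?_
  rintro _ ⟨x, hx, rfl⟩
  exact h _ (by simpa using (Finset.mem_powersetCard.mp hS).2) x hx

theorem productImage_le_filtration (hTF : ∀ i p x, x ∈ F (p + 1) → T i x ∈ F p) (m p : ℕ) :
    productImage T F m p ≤ F p :=
  productImage_le fun l hl x hx => prod_map_mem_filtration hTF l p x (by rwa [hl])

theorem productImage_le_one (hT : IsExteriorFamily T)
    (hTF : ∀ i p x, x ∈ F (p + 1) → T i x ∈ F p) {m : ℕ} (hm : 1 ≤ m) (p : ℕ) :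
    productImage T F m p ≤ productImage T F 1 p := by
  refine productImage_le fun l hl x hx => ?_
  match l, hl with
  | [], hl => simp only [List.length_nil] at hl; omega
  | i :: l, hl =>
    have h := hT.prod_map_mem_productImage (F := F) (p := p) (l := [i]) rfl
      (prod_map_mem_filtration hTF l (p + 1) x (by
        rw [List.length_cons] at hl
        rwa [Nat.add_assoc, Nat.add_comm 1, hl]))
    simpa using h

theorem prod_map_mem_productImage_succ (hT : IsExteriorFamily T) {m p : ℕ} {l : List ι}
    (hl : l.length = m) {b : L} (hb : b ∈ productImage T F 1 (p + m)) :
    (l.map T).prod b ∈ productImage T F (m + 1) p := by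
  have : productImage T F 1 (p + m) ≤ (productImage T F (m + 1) p).comap (l.map T).prod := by
    refine productImage_le fun l' hl' x hx => ?_
    have := hT.prod_map_mem_productImage (F := F) (p := p) (m := m + 1) (l := l ++ l')
      (by simp [hl, hl']) hx
    simpa using this
  exact this hb

/-- The de Rham--Saito division lemma. -/
theorem mem_productImage_sup (hT : IsExteriorFamily T)
    (hTF : ∀ i p x, x ∈ F (p + 1) → T i x ∈ F p) (hF : Antitone F) {N r : ℕ} (hN : F N = ⊥)
    (J : ℕ → Submodule A L) (hTJ : ∀ s i x, x ∈ J s → T i x ∈ J s)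
    (a : ℕ → A) (hJ : ∀ s, J s ≤ J (s + 1)) (haJ : ∀ s < r, ∀ x, a s • x ∈ J (s + 1))
    (hreg : ∀ s < r, ∀ x, a s • x ∈ J s → x ∈ J s)
    (hdec : ∀ s < r, ∀ p, ∀ x ∈ F p, x ∈ J (s + 1) → ∃ z ∈ F p, x - a s • z ∈ J s)
    (hcramer : ∀ s < r, ∀ p, ∀ x ∈ F p, ((Finset.univ : Finset ι).toList.map T).prod x ∈ J s →
      a s • x ∈ productImage T F 1 p ⊔ J s) (n : ℕ) :
    ∀ p s : ℕ, N ≤ p + n → s + n ≤ r → ∀ x ∈ F p,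
      ((Finset.univ : Finset ι).toList.map T).prod x ∈ J s →
      x ∈ productImage T F 1 p ⊔ J s := by
  classical
  -- `n` bounds both the degrees left before the filtration vanishes and the unused elements of the
  -- sequence. Each use of the hypothesis raises `s` by one and `p` by some `m ≥ 1`.
  induction n with
  | zero =>
    intro p s hp _ x hx _
    have : x ∈ F N := hF (by omega) hx
    rw [hN, Submodule.mem_bot] at this
    simp [this]
  | succ n ih =>
    intro p s hp hs x hx hTx
    have hsr : s < r := by omega
    -- Cancellation of `a s`, by descending induction on `m`. Once `m` exceeds the number of
    -- operators, `productImage` is zero and regularity of `a s` modulo `J s` concludes.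
    have inner : ∀ k m : ℕ, 1 ≤ m → Fintype.card ι + 1 ≤ m + k → ∀ y ∈ F p,
        a s • y ∈ productImage T F m p ⊔ J s → y ∈ productImage T F 1 p ⊔ J s := by
      intro k
      induction k with
      | zero =>
        intro m _ hmc y _ hay
        have : productImage T F m p = ⊥ := by
          rw [productImage, Finset.powersetCard_eq_empty.mpr (by simpa using by omega)]
          simp
        rw [this, bot_sup_eq] at hay
        exact Submodule.mem_sup_right (hreg s hsr y hay)
      | succ k ihk =>
        intro m hm hmc y hy hay
        obtain ⟨b, hb, j, hj, hbj⟩ := Submodule.mem_sup.mp hay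
        rw [productImage, Submodule.mem_iSup_finset_iff_exists_sum] at hb
        obtain ⟨f, hf⟩ := hb
        have hf' : ∀ S : Finset ι, ∃ η ∈ F (p + m), (S.toList.map T).prod η = f S := fun S =>
          (f S).2
        choose η hηF hη using hf'
        have key : ∀ S ∈ Finset.powersetCard m (Finset.univ : Finset ι),
            ∃ z ∈ F (p + m), η S - a s • z ∈ productImage T F 1 (p + m) ⊔ J s := by
          intro S hS
          have hSm : S.card = m := (Finset.mem_powersetCard.mp hS).2
          -- The product over the complement of `S` kills every term with `S' ≠ S` of the same size,
          -- since `S'` then meets the complement. Only the full product applied to `η S` survives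
          -- modulo `J (s + 1)`.
          have h₁ : (Sᶜ.toList.map T).prod (a s • y) ∈ J (s + 1) := by
            rw [map_smul]; exact haJ s hsr _
          have h₂ : (Sᶜ.toList.map T).prod j ∈ J (s + 1) :=
            prod_map_mem_of_invariant (hTJ (s + 1)) _ (hJ s hj)
          rw [← hbj, map_add, ← hf, map_sum] at h₁
          have h₃ := (Submodule.add_mem_iff_left _ h₂).mp h₁
          rw [Finset.sum_eq_single_of_mem S hS] at h₃
          · have hperm : (Sᶜ.toList ++ S.toList).Perm (Finset.univ : Finset ι).toList := by
              have hnd : (Sᶜ.toList ++ S.toList).Nodup := by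
                rw [List.nodup_append']
                refine ⟨Finset.nodup_toList _, Finset.nodup_toList _, fun i hi hi' => ?_⟩
                simp only [Finset.mem_toList, Finset.mem_compl] at hi hi'
                exact hi hi'
              rw [List.perm_ext_iff_of_nodup hnd (Finset.nodup_toList _)]
              intro i
              simp [or_comm, em]
            have h₄ : ((Finset.univ : Finset ι).toList.map T).prod (η S) ∈ J (s + 1) := by
              refine hT.prod_map_mem_of_perm hperm ?_
              rw [List.map_append, List.prod_append, Module.End.mul_apply, hη]
              exact h₃
            have h₅ := ih (p + m) (s + 1) (by omega) (by omega) _ (hηF S) h₄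
            obtain ⟨b', hb', j', hj', hbj'⟩ := Submodule.mem_sup.mp h₅
            have hj'F : j' ∈ F (p + m) := by
              rw [← add_sub_cancel_left b' j', hbj']
              exact sub_mem (hηF S) (productImage_le_filtration hTF _ _ hb')
            obtain ⟨z, hz, hjz⟩ := hdec s hsr _ j' hj'F hj'
            refine ⟨z, hz, ?_⟩
            rw [← hbj', add_sub_assoc]
            exact Submodule.add_mem_sup hb' hjz
          · intro S' hS' hne
            have hS'm : S'.card = m := (Finset.mem_powersetCard.mp hS').2
            rw [← hη, ← Module.End.mul_apply, ← List.prod_append, ← List.map_append,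
              hT.prod_map_eq_zero, LinearMap.zero_apply]
            intro hnd
            refine hne (Finset.eq_of_subset_of_card_le (fun i hi => ?_) (by omega))
            by_contra his
            exact List.disjoint_left.mp (List.nodup_append'.mp hnd).2.2
              (Finset.mem_toList.mpr (Finset.mem_compl.mpr his)) (Finset.mem_toList.mpr hi)
        choose! z hzF hz using key
        have hzB : ∑ S ∈ Finset.powersetCard m (Finset.univ : Finset ι),
            (S.toList.map T).prod (z S) ∈ productImage T F m p :=
          Submodule.sum_mem _ fun S hS => hT.prod_map_mem_productImage
            (by simpa using (Finset.mem_powersetCard.mp hS).2) (hzF S hS)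
        -- Subtracting the terms with coefficients `z S` from `y` changes it within `productImage T
        -- F m p` and leaves `a s` times the difference in the image of `(m + 1)`-fold products,
        -- modulo `J s`.
        have hmem := ihk (m + 1) (by omega) (by omega)
          (y - ∑ S ∈ Finset.powersetCard m (Finset.univ : Finset ι), (S.toList.map T).prod (z S))
          (sub_mem hy (productImage_le_filtration hTF _ _ hzB)) (by
            rw [smul_sub, ← hbj, ← hf, Finset.smul_sum, add_sub_right_comm,
              ← Finset.sum_sub_distrib]
            refine Submodule.add_mem _ (Submodule.sum_mem _ fun S hS => ?_)
              (Submodule.mem_sup_right hj)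
            rw [← hη, ← map_smul, ← map_sub]
            obtain ⟨b', hb', j', hj', hbj'⟩ := Submodule.mem_sup.mp (hz S hS)
            rw [← hbj', map_add]
            exact Submodule.add_mem_sup (hT.prod_map_mem_productImage_succ
              (by simpa using (Finset.mem_powersetCard.mp hS).2) hb')
              (prod_map_mem_of_invariant (hTJ s) _ hj'))
        have := Submodule.add_mem _ hmem
          (Submodule.mem_sup_left (productImage_le_one hT hTF hm p hzB))
        simpa using this
    exact inner (Fintype.card ι) 1 le_rfl (by omega) x hx (hcramer s hsr p x hx hTx)

end IsExteriorFamily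

/-! ### Contraction, exterior multiplication and coefficients of alternating forms -/

section AlternatingForms

variable (A M : Type*) [CommRing A] [AddCommGroup M] [Module A M]

/-- Families consisting of one alternating form of each degree. -/
abbrev AlternatingForms := ∀ p : ℕ, M [⋀^Fin p]→ₗ[A] A

namespace AlternatingForms

variable {A M}

/-- The interior product with a vector. -/
def contract (ω : M) : Module.End A (AlternatingForms A M) where
  toFun c p := (c (p + 1)).curryLeft ω
  map_add' _ _ := rfl
  map_smul' _ _ := rfl

@[simp]
theorem contract_apply (ω : M) (c : AlternatingForms A M) (p : ℕ) (m : Fin p → M) :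
    contract ω c p m = c (p + 1) (Matrix.vecCons ω m) := rfl

/-- The exterior product with a linear form on the left. -/
def wedge (φ : M →ₗ[A] A) : Module.End A (AlternatingForms A M) where
  toFun c
    | 0 => 0
    | p + 1 => AlternatingMap.alternatizeUncurryFin (φ.smulRight (c p))
  map_add' c c' := by
    ext p m
    cases p with
    | zero => simp
    | succ p => simp [AlternatingMap.alternatizeUncurryFin_apply, Finset.sum_add_distrib]
  map_smul' r c := by
    ext p m
    cases p with
    | zero => simp
    | succ p =>
      simp [AlternatingMap.alternatizeUncurryFin_apply, Finset.mul_sum, mul_left_comm]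

@[simp]
theorem wedge_apply_zero (φ : M →ₗ[A] A) (c : AlternatingForms A M) : wedge φ c 0 = 0 := rfl

theorem wedge_apply_succ (φ : M →ₗ[A] A) (c : AlternatingForms A M) (p : ℕ)
    (m : Fin (p + 1) → M) :
    wedge φ c (p + 1) m = ∑ i : Fin (p + 1), (-1) ^ (i : ℕ) * (φ (m i) * c p (i.removeNth m)) := by
  change AlternatingMap.alternatizeUncurryFin (φ.smulRight (c p)) m = _
  simp [AlternatingMap.alternatizeUncurryFin_apply]

/-- With `ω` as first argument, the leading term of the wedge expansion is `φ ω • c`; the others are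
shifted by one place, hence change sign and cancel. This is the homotopy required in Cramer's rule.
-/
theorem wedge_contract_add (φ : M →ₗ[A] A) (ω : M) (c : AlternatingForms A M) :
    wedge φ (contract ω c) + contract ω (wedge φ c) = φ ω • c := by
  ext p m
  cases p with
  | zero =>
    simp only [Pi.add_apply, wedge_apply_zero, contract_apply,
      wedge_apply_succ, zero_add, Pi.smul_apply, AlternatingMap.smul_apply, smul_eq_mul]
    simp
  | succ p =>
    simp only [Pi.add_apply, AlternatingMap.add_apply, contract_apply, wedge_apply_succ,
      Pi.smul_apply, AlternatingMap.smul_apply, smul_eq_mul]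
    rw [Fin.sum_univ_succ (n := p + 1)]
    have h0 : (0 : Fin (p + 2)).removeNth (Matrix.vecCons ω m) = m := by
      ext j; simp [Fin.removeNth]
    have hs : ∀ i : Fin (p + 1), i.succ.removeNth (Matrix.vecCons ω m) =
        Matrix.vecCons ω (i.removeNth m) := by
      intro i
      ext j
      cases j using Fin.cases <;> simp [Fin.removeNth]
    simp [h0, hs, pow_succ, Finset.sum_neg_distrib]

theorem isExteriorFamily_contract {ι : Type*} (ω : ι → M) :
    IsExteriorFamily fun i => contract (A := A) (ω i) where
  sq_zero i := by
    ext c p m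
    simp only [Module.End.mul_apply, contract_apply, LinearMap.zero_apply, Pi.zero_apply,
      AlternatingMap.zero_apply]
    exact (c (p + 2)).map_eq_zero_of_eq _ (i := 0) (j := 1) (by simp) (by simp)
  anticomm i j := by
    ext c p m
    simp only [Module.End.mul_apply, contract_apply, LinearMap.neg_apply, Pi.neg_apply,
      AlternatingMap.neg_apply]
    rw [← (c (p + 2)).map_swap _ (i := 0) (j := 1) (by simp)]
    congr 1
    ext k
    refine Fin.cases ?_ (fun k => Fin.cases ?_ (fun k => ?_) k) k
    · simp
    · simp
    · rw [Function.comp_apply, Equiv.swap_apply_of_ne_of_ne]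
      · simp
      · simp
      · simp [Fin.ext_iff]

variable (A M) in
/-- The families of forms which vanish in degrees less than `p`. -/
def degreeGE (p : ℕ) : Submodule A (AlternatingForms A M) where
  carrier := {c | ∀ q < p, c q = 0}
  add_mem' hc hc' q hq := by simp [hc q hq, hc' q hq]
  zero_mem' _ _ := rfl
  smul_mem' r c hc q hq := by simp [hc q hq]

@[simp]
theorem mem_degreeGE {p : ℕ} {c : AlternatingForms A M} :
    c ∈ degreeGE A M p ↔ ∀ q < p, c q = 0 := Iff.rfl

theorem degreeGE_antitone : Antitone (degreeGE A M) := fun _ _ h _ hc q hq =>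
  hc q (hq.trans_le h)

theorem contract_mem_degreeGE (ω : M) {p : ℕ} {c : AlternatingForms A M}
    (hc : c ∈ degreeGE A M (p + 1)) : contract ω c ∈ degreeGE A M p := by
  intro q hq
  ext m
  simp [hc (q + 1) (by omega)]

theorem wedge_mem_degreeGE (φ : M →ₗ[A] A) {p : ℕ} {c : AlternatingForms A M}
    (hc : c ∈ degreeGE A M p) : wedge φ c ∈ degreeGE A M (p + 1) := by
  intro q hq
  cases q with
  | zero => rfl
  | succ q =>
    ext m
    simp [wedge_apply_succ, hc q (by omega)]

variable (M) in
/-- The families of forms with values in an ideal. -/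
def valuesIn (I : Ideal A) : Submodule A (AlternatingForms A M) where
  carrier := {c | ∀ p m, c p m ∈ I}
  add_mem' hc hc' p m := I.add_mem (hc p m) (hc' p m)
  zero_mem' _ _ := I.zero_mem
  smul_mem' r _ hc p m := I.mul_mem_left r (hc p m)

@[simp]
theorem mem_valuesIn {I : Ideal A} {c : AlternatingForms A M} :
    c ∈ valuesIn M I ↔ ∀ p m, c p m ∈ I := Iff.rfl

theorem contract_mem_valuesIn (ω : M) {I : Ideal A} {c : AlternatingForms A M}
    (hc : c ∈ valuesIn M I) : contract ω c ∈ valuesIn M I := fun _ _ => hc _ _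

theorem wedge_mem_valuesIn (φ : M →ₗ[A] A) {I : Ideal A} {c : AlternatingForms A M}
    (hc : c ∈ valuesIn M I) : wedge φ c ∈ valuesIn M I := by
  intro p m
  cases p with
  | zero => simp
  | succ p =>
    rw [wedge_apply_succ]
    exact sum_mem fun i _ => I.mul_mem_left _ (I.mul_mem_left _ (hc _ _))

/-- The value of a family of forms on a list of vectors. -/
def evalList (c : AlternatingForms A M) (L : List M) : A := c L.length L.get

theorem evalList_eq (c : AlternatingForms A M) {p : ℕ} (m : Fin p → M) :
    evalList c (List.ofFn m) = c p m := by
  have : ∀ (L : List M) (h : L.length = p), evalList c L = c p fun i => L.get (i.cast h.symm) := by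
    rintro L rfl; rfl
  rw [this _ (List.length_ofFn ..)]
  congr 1
  ext i
  simp

theorem evalList_contract (ω : M) (c : AlternatingForms A M) (L : List M) :
    evalList (contract ω c) L = evalList c (ω :: L) := by
  rw [evalList, contract_apply]
  change _ = c (L.length + 1) (ω :: L).get
  congr 1
  ext k
  cases k using Fin.cases <;> simp

/-- The outermost contraction inserts its vector first, next to `L`, hence the reversal. Lists avoid
casts between arities. -/
theorem evalList_prod_contract {ι : Type*} (ω : ι → M) (l : List ι) (L : List M)
    (c : AlternatingForms A M) :
    evalList ((l.map fun i => contract (A := A) (ω i)).prod c) L =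
      evalList c ((l.map ω).reverse ++ L) := by
  induction l generalizing L with
  | nil => simp
  | cons i l ih => simp [evalList_contract, ih]

theorem eq_zero_of_lt {v p : ℕ} (c : (Fin v → A) [⋀^Fin p]→ₗ[A] A) (h : v < p) : c = 0 := by
  refine Module.Basis.ext_alternating (Pi.basisFun A (Fin v)) fun f hf => ?_
  have := Fintype.card_le_of_injective f hf
  simp only [Fintype.card_fin] at this
  omega

theorem apply_vecCons_mem {v p : ℕ} (I : Ideal A) (c : (Fin v → A) [⋀^Fin (p + 1)]→ₗ[A] A)
    {ω : Fin v → A} (hω : ∀ j, ω j ∈ I) (m : Fin p → Fin v → A) :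
    c (Matrix.vecCons ω m) ∈ I := by
  let f : (Fin v → A) →ₗ[A] A :=
    { toFun := fun ω => c.curryLeft ω m
      map_add' := by simp only [map_add, AlternatingMap.add_apply, implies_true]
      map_smul' := by simp only [map_smul, AlternatingMap.smul_apply, RingHom.id_apply,
        implies_true] }
  change f ω ∈ I
  rw [f.pi_apply_eq_sum_univ]
  exact I.sum_mem fun j _ => I.mul_mem_right _ (hω j)

theorem degreeGE_eq_bot (v : ℕ) : degreeGE A (Fin v → A) (v + 1) = ⊥ := by
  rw [eq_bot_iff]
  intro c hc
  ext p m
  rcases lt_or_ge p (v + 1) with h | h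
  · simp [hc p h]
  · simp [eq_zero_of_lt (c p) h]

/-- The exterior power of `A ^ v` is free: quotients are chosen on a basis and extended linearly. -/
theorem exists_form_sub_smul {v p : ℕ} (I : Ideal A) (a : A) (c : (Fin v → A) [⋀^Fin p]→ₗ[A] A)
    (hc : ∀ m, ∃ z, c m - a * z ∈ I) :
    ∃ ζ : (Fin v → A) [⋀^Fin p]→ₗ[A] A, ∀ m, c m - a * ζ m ∈ I := by
  let B := (Pi.basisFun A (Fin v)).exteriorPower p
  let c' := exteriorPower.alternatingMapLinearEquiv c
  have hB : ∀ S, ∃ z, c' (B S) - a * z ∈ I := by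
    intro S
    simp only [B, c', exteriorPower.basis_apply, exteriorPower.ιMulti_family,
      exteriorPower.alternatingMapLinearEquiv_apply_ιMulti]
    exact hc _
  choose z hz using hB
  refine ⟨exteriorPower.alternatingMapLinearEquiv.symm (B.constr A z), fun m => ?_⟩
  have : ∀ x, c' x - a * B.constr A z x ∈ I := by
    intro x
    induction B.mem_span x using Submodule.span_induction with
    | mem x hx => obtain ⟨S, rfl⟩ := hx; simpa using hz S
    | zero => simp
    | add x y _ _ hx hy => convert I.add_mem hx hy using 1; simp only [map_add]; ring
    | smul r x _ hx => convert I.mul_mem_left r hx using 1; simp only [map_smul, smul_eq_mul]; ring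
  simpa [c'] using this (exteriorPower.ιMulti A p m)

theorem exists_sub_smul_mem_valuesIn {v p : ℕ} {I I' : Ideal A} {a : A}
    (hI : ∀ f ∈ I', ∃ g, f - a * g ∈ I) {c : AlternatingForms A (Fin v → A)}
    (hc : c ∈ degreeGE A _ p) (hcI : c ∈ valuesIn _ I') :
    ∃ z ∈ degreeGE A (Fin v → A) p, c - a • z ∈ valuesIn _ I := by
  have := fun q => exists_form_sub_smul I a (c q) fun m => hI _ (hcI q m)
  choose ζ hζ using this
  refine ⟨fun q => if q < p then 0 else ζ q, fun q hq => if_pos hq, fun q m => ?_⟩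
  by_cases hq : q < p
  · simp [hq, hc q hq]
  · simpa [hq] using hζ q m

theorem smul_mem_valuesIn {I : Ideal A} {a : A} (ha : a ∈ I) (c : AlternatingForms A M) :
    a • c ∈ valuesIn M I := fun _ _ => I.mul_mem_right _ ha

theorem mem_valuesIn_of_smul_mem {I : Ideal A} {a : A} (ha : ∀ f, a * f ∈ I → f ∈ I)
    {c : AlternatingForms A M} (hc : a • c ∈ valuesIn M I) : c ∈ valuesIn M I :=
  fun p m => ha _ (hc p m)

theorem valuesIn_mono : Monotone (valuesIn (A := A) M) := fun _ _ h _ hc p m => h (hc p m)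

end AlternatingForms

end AlternatingForms

/-! ### Cramer's rule for contraction with the columns of a matrix -/

namespace AlternatingForms

open IsExteriorFamily

variable {A : Type*} [CommRing A]

theorem det_pow_smul_mem {v d : ℕ} (M : Matrix (Fin v) (Fin d) A) (N : Matrix (Fin d) (Fin v) A)
    (I : Ideal A) (p : ℕ) (c : AlternatingForms A (Fin v → A)) (hc : c ∈ degreeGE A _ p)
    (hMc : ((Finset.univ : Finset (Fin d)).toList.map fun i => contract (A := A) (M.col i)).prod c ∈
      valuesIn _ I) :
    (N * M).det ^ d • c ∈ productImage (fun i => contract (A := A) (M.col i))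
      (degreeGE A (Fin v → A)) 1 p ⊔ valuesIn _ I := by
  have hT := isExteriorFamily_contract (A := A) fun i => M.col i
  -- The rows of `adj(N M) N` are dual to the columns of `M` up to the factor `det (N M)`.
  let φ : Fin d → (Fin v → A) →ₗ[A] A := fun i =>
    LinearMap.proj i ∘ₗ ((N * M).adjugate * N).mulVecLin
  have hφ : ∀ i j, φ i (M.col j) = if i = j then (N * M).det else 0 := by
    intro i j
    have h : ((N * M).adjugate * N * M) i j = if i = j then (N * M).det else 0 := by
      rw [Matrix.mul_assoc, Matrix.adjugate_mul, Matrix.smul_apply, Matrix.one_apply]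
      split_ifs <;> simp
    rw [← h]
    rfl
  obtain ⟨g, hg, hgc⟩ := exists_pow_smul_sub_sum_mem hT (F := degreeGE A (Fin v → A))
    (by ext; simp) degreeGE_antitone (fun i p x => contract_mem_degreeGE _)
    (fun i => wedge (φ i)) (N * M).det (fun i j x => by
      rw [wedge_contract_add, hφ]; split_ifs <;> simp)
    (fun i p x => wedge_mem_degreeGE _) (valuesIn _ I) (fun i x => wedge_mem_valuesIn _)
    (Finset.univ : Finset (Fin d)).toList (Finset.nodup_toList _) p c hc hMc
  rw [Finset.length_toList, Finset.card_univ, Fintype.card_fin] at hgc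
  rw [← sub_add_cancel ((N * M).det ^ d • c) (∑ i ∈ (Finset.univ : Finset (Fin d)).toList.toFinset,
    contract (M.col i) (g i)), add_comm]
  refine Submodule.add_mem_sup (Submodule.sum_mem _ fun i _ => ?_) hgc
  simpa using hT.prod_map_mem_productImage (F := degreeGE A (Fin v → A)) (p := p) (l := [i]) rfl
    (hg i)

theorem smul_mem_of_mem_span {v d : ℕ} (M : Matrix (Fin v) (Fin d) A)
    (𝒩 : Set (Matrix (Fin d) (Fin v) A)) {a : A}
    (ha : a ∈ Ideal.span ((fun N : Matrix (Fin d) (Fin v) A => (N * M).det ^ d) '' 𝒩))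
    (I : Ideal A) (p : ℕ) (c : AlternatingForms A (Fin v → A)) (hc : c ∈ degreeGE A _ p)
    (hMc : ((Finset.univ : Finset (Fin d)).toList.map fun i => contract (A := A) (M.col i)).prod c ∈
      valuesIn _ I) :
    a • c ∈ productImage (fun i => contract (A := A) (M.col i))
      (degreeGE A (Fin v → A)) 1 p ⊔ valuesIn _ I := by
  induction ha using Submodule.span_induction with
  | mem a ha =>
    obtain ⟨N, _, rfl⟩ := ha
    exact det_pow_smul_mem M N I p c hc hMc
  | zero => simp
  | add a b _ _ ha hb => rw [add_smul]; exact add_mem ha hb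
  | smul r a _ ha => rw [smul_eq_mul, mul_smul]; exact Submodule.smul_mem _ _ ha

end AlternatingForms

/-! ### Linear independence of the maximal minors in the critical dimension -/

namespace MvPolynomial

variable {K : Type*} [Field K]

/-- The ideal generated by powers of the first `s` variables. -/
def varPowIdeal {u : ℕ} (e : Fin u → ℕ) (s : ℕ) : Ideal (MvPolynomial (Fin u) K) :=
  Ideal.span ((fun m => monomial m 1) '' {m | ∃ i : Fin u, i.val < s ∧ m = Finsupp.single i (e i)})

theorem mem_varPowIdeal {u : ℕ} {e : Fin u → ℕ} {s : ℕ} {f : MvPolynomial (Fin u) K} :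
    f ∈ varPowIdeal e s ↔ ∀ m ∈ f.support, ∃ i : Fin u, i.val < s ∧ e i ≤ m i := by
  rw [varPowIdeal, mem_ideal_span_monomial_image]
  refine forall₂_congr fun m _ => ⟨?_, ?_⟩
  · rintro ⟨_, ⟨i, hi, rfl⟩, h⟩
    exact ⟨i, hi, Finsupp.single_le_iff.mp h⟩
  · rintro ⟨i, hi, h⟩
    exact ⟨_, ⟨i, hi, rfl⟩, Finsupp.single_le_iff.mpr h⟩

theorem varPowIdeal_mono {u : ℕ} (e : Fin u → ℕ) :
    Monotone (varPowIdeal (K := K) e) := fun s t h f hf => by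
  rw [mem_varPowIdeal] at hf ⊢
  intro m hm
  obtain ⟨i, hi, h'⟩ := hf m hm
  exact ⟨i, hi.trans_le h, h'⟩

theorem X_pow_mem_varPowIdeal {u : ℕ} (e : Fin u → ℕ) (i : Fin u) :
    X i ^ e i ∈ varPowIdeal (K := K) e (i.val + 1) := by
  rw [X_pow_eq_monomial]
  exact Ideal.subset_span ⟨_, ⟨i, Nat.lt_succ_self _, rfl⟩, rfl⟩

/-- The ideal is generated by monomials in the variables before `X i`, so multiplying by a power of
`X i` does not affect membership. Thus the powers form a regular sequence. -/
theorem mem_varPowIdeal_of_X_pow_mul_mem {u : ℕ} (e : Fin u → ℕ) (i : Fin u)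
    {f : MvPolynomial (Fin u) K} (h : X i ^ e i * f ∈ varPowIdeal e i.val) :
    f ∈ varPowIdeal e i.val := by
  rw [mem_varPowIdeal] at h ⊢
  intro m hm
  obtain ⟨j, hj, hjm⟩ := h (m + Finsupp.single i (e i)) (by
    rw [mem_support_iff, X_pow_eq_monomial, mul_comm, coeff_mul_monomial, mul_one]
    exact mem_support_iff.mp hm)
  refine ⟨j, hj, ?_⟩
  have hij : i ≠ j := by rintro rfl; exact lt_irrefl _ hj
  simpa [Finsupp.single_eq_of_ne hij.symm] using hjm

theorem exists_sub_X_pow_mul_mem {u : ℕ} (e : Fin u → ℕ) (i : Fin u)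
    {f : MvPolynomial (Fin u) K} (h : f ∈ varPowIdeal e (i.val + 1)) :
    ∃ g, f - X i ^ e i * g ∈ varPowIdeal e i.val := by
  induction h using Submodule.span_induction with
  | mem f hf =>
    obtain ⟨_, ⟨j, hj, rfl⟩, rfl⟩ := hf
    rcases (Nat.lt_succ_iff_lt_or_eq.mp hj) with hj | hj
    · refine ⟨0, ?_⟩
      rw [mul_zero, sub_zero]
      exact Ideal.subset_span ⟨_, ⟨j, hj, rfl⟩, rfl⟩
    · obtain rfl := Fin.ext hj
      exact ⟨1, by simp [X_pow_eq_monomial]⟩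
  | zero => exact ⟨0, by simp⟩
  | add f f' _ _ h h' =>
    obtain ⟨g, hg⟩ := h
    obtain ⟨g', hg'⟩ := h'
    exact ⟨g + g', by convert add_mem hg hg' using 1; ring⟩
  | smul r f _ h =>
    obtain ⟨g, hg⟩ := h
    exact ⟨r * g, by convert Ideal.mul_mem_left _ r hg using 1; simp only [smul_eq_mul]; ring⟩

/-- By the Nullstellensatz it is enough that the determinants have no common zero `x ≠ 0`. At such
an `x`, a left inverse of the injective matrix `M(x)`, taken as a constant matrix `N`, gives `det (N
M)` the value one. -/
theorem exists_X_pow_mem_span_det_pow [IsAlgClosed K] {u v d : ℕ}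
    (M : Matrix (Fin v) (Fin d) (MvPolynomial (Fin u) K))
    (hM : ∀ x : Fin u → K, x ≠ 0 → Function.Injective (M.map (eval x)).mulVec) (i : Fin u) :
    ∃ e, X i ^ e ∈ Ideal.span
      ((fun N : Matrix (Fin d) (Fin v) (MvPolynomial (Fin u) K) => (N * M).det ^ d) '' Set.univ) := by
  change X i ∈ Ideal.radical _
  rw [← vanishingIdeal_zeroLocus_eq_radical (K := K)]
  intro x hx
  rw [aeval_X]
  by_contra hxi
  have hx0 : x ≠ 0 := fun h => hxi (by simp [h])
  obtain ⟨L, hL⟩ := ((M.map (eval x)).mulVecLin).exists_leftInverse_of_injective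
    (LinearMap.ker_eq_bot.mpr (hM x hx0))
  have hN : LinearMap.toMatrix' L * M.map (eval x) = 1 := by
    rw [← LinearMap.toMatrix'_id, ← hL, LinearMap.toMatrix'_comp,
      ← Matrix.toLin'_apply', LinearMap.toMatrix'_toLin']
  let P : Matrix (Fin d) (Fin v) (MvPolynomial (Fin u) K) := (LinearMap.toMatrix' L).map C
  have h := mem_zeroLocus_iff.mp hx _ (Ideal.subset_span ⟨P, trivial, rfl⟩)
  have he : (eval x).mapMatrix (P * M) = 1 := by
    rw [RingHom.mapMatrix_apply, Matrix.map_mul, ← hN, Matrix.map_map]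
    congr 1
    ext i j
    simp
  dsimp only at h
  rw [aeval_eq_eval, map_pow, RingHom.map_det, he] at h
  simp at h

-- Forms on `A ^ v` vanish from degree `v + 1` on, so `v + 1 - d` steps, and hence `u` powers of
-- variables, are enough for the division lemma in degree `d`.
open AlternatingForms IsExteriorFamily in
theorem mem_productImage_contract [IsAlgClosed K] {u v d : ℕ}
    (M : Matrix (Fin v) (Fin d) (MvPolynomial (Fin u) K))
    (hM : ∀ x : Fin u → K, x ≠ 0 → Function.Injective (M.map (eval x)).mulVec)
    (h : v + 1 ≤ d + u)
    (c : AlternatingForms (MvPolynomial (Fin u) K) (Fin v → MvPolynomial (Fin u) K))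
    (hc : c ∈ degreeGE _ _ d)
    (hTc : ((Finset.univ : Finset (Fin d)).toList.map fun i => contract (M.col i)).prod c ∈
      valuesIn _ ⊥) :
    c ∈ productImage (fun i => contract (M.col i)) (degreeGE _ _) 1 d ⊔ valuesIn _ ⊥ := by
  choose e he using exists_X_pow_mem_span_det_pow M hM
  have h0 : varPowIdeal (K := K) e 0 = ⊥ := by simp [varPowIdeal]
  rw [← h0] at hTc ⊢
  have hT := isExteriorFamily_contract (A := MvPolynomial (Fin u) K) fun i => M.col i
  exact hT.mem_productImage_sup (F := degreeGE _ (Fin v → MvPolynomial (Fin u) K))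
    (fun i p x => contract_mem_degreeGE _) degreeGE_antitone (N := v + 1) (r := u)
    (degreeGE_eq_bot v) (fun s => valuesIn _ (varPowIdeal e s))
    (fun s i x => contract_mem_valuesIn _)
    (fun s => if hs : s < u then X ⟨s, hs⟩ ^ e ⟨s, hs⟩ else 0)
    (fun s => valuesIn_mono (varPowIdeal_mono e (Nat.le_succ s)))
    (fun s hs x => by
      rw [dif_pos hs]
      exact smul_mem_valuesIn (X_pow_mem_varPowIdeal e ⟨s, hs⟩) x)
    (fun s hs x hx => by
      rw [dif_pos hs] at hx
      exact mem_valuesIn_of_smul_mem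
        (fun f => mem_varPowIdeal_of_X_pow_mul_mem e ⟨s, hs⟩) hx)
    (fun s hs p x hx hxs => by
      rw [dif_pos hs]
      exact exists_sub_smul_mem_valuesIn
        (fun f => exists_sub_X_pow_mul_mem e ⟨s, hs⟩) hx hxs)
    (fun s hs p x hx hTx => by
      rw [dif_pos hs]
      exact smul_mem_of_mem_span M _ (he ⟨s, hs⟩) _ p x hx hTx)
    u d 0 (by omega) (by omega) c hc hTc

open AlternatingForms IsExteriorFamily Set.powersetCard in
theorem linearIndependent_maximal_minors [IsAlgClosed K] {u v d : ℕ}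
    (M : Matrix (Fin v) (Fin d) (MvPolynomial (Fin u) K))
    (hM₁ : ∀ i j, (M i j).IsHomogeneous 1)
    (hM : ∀ x : Fin u → K, x ≠ 0 → Function.Injective (M.map (eval x)).mulVec)
    (h : v + 1 ≤ d + u) :
    LinearIndependent K fun S : Set.powersetCard (Fin v) d =>
      (M.submatrix (ofFinEmbEquiv.symm S) id).det := by
  rw [Fintype.linearIndependent_iff]
  intro a ha S₀
  let A := MvPolynomial (Fin u) K
  let b := Pi.basisFun A (Fin v)
  have hT := isExteriorFamily_contract (A := A) fun i => M.col i
  let γ : (Fin v → A) [⋀^Fin d]→ₗ[A] A :=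
    (∑ S, (C (a S) : A) • exteriorPower.ιMultiDual A d b S).compAlternatingMap
      (exteriorPower.ιMulti A d)
  -- The relation, encoded as a form concentrated in degree `d` whose coefficients on the standard
  -- basis are the constants `a S`.
  let c : AlternatingForms A (Fin v → A) := Function.update 0 d γ
  have hcd : c d = γ := Function.update_self ..
  have hcF : c ∈ degreeGE A (Fin v → A) d := fun q hq => Function.update_of_ne hq.ne _ _
  have hγM : γ M.col = 0 := by
    simp only [γ, LinearMap.compAlternatingMap_apply, LinearMap.sum_apply, LinearMap.smul_apply,
      exteriorPower.ιMultiDual_apply_ιMulti, smul_eq_mul, ← MvPolynomial.smul_eq_C_mul]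
    rw [← ha]
    refine Finset.sum_congr rfl fun S _ => ?_
    rw [← Matrix.det_transpose]
    rfl
  have hγS : γ (b ∘ ofFinEmbEquiv.symm S₀) = C (a S₀) := by
    have := fun S => exteriorPower.ιMultiDual_apply_nondiag A d b S S₀
    have h1 := exteriorPower.ιMultiDual_apply_diag A d b S₀
    simp only [exteriorPower.ιMulti_family] at this h1
    simp only [γ, LinearMap.compAlternatingMap_apply, LinearMap.sum_apply, LinearMap.smul_apply]
    rw [Finset.sum_eq_single S₀, h1, smul_eq_mul, mul_one]
    · intro S _ hS
      rw [this S hS, smul_zero]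
    · simp
  have hTc : ((Finset.univ : Finset (Fin d)).toList.map
      fun i => contract (A := A) (M.col i)).prod c ∈ valuesIn _ ⊥ := by
    -- The reversed order compensates for the reversal in `evalList_prod_contract`, so that `γ` is
    -- evaluated at the columns in their natural order.
    have hp : ((List.finRange d).reverse).Perm (Finset.univ : Finset (Fin d)).toList := by
      rw [List.perm_ext_iff_of_nodup (List.nodup_reverse.mpr (List.nodup_finRange d))
        (Finset.nodup_toList _)]
      simp
    refine hT.prod_map_mem_of_perm hp ?_
    intro p m
    rw [← evalList_eq, evalList_prod_contract]
    cases p with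
    | zero =>
      rw [List.map_reverse, List.reverse_reverse, List.ofFn_zero, List.append_nil,
        ← List.ofFn_eq_map, evalList_eq, hcd]
      change γ M.col ∈ _
      rw [hγM]
      exact zero_mem _
    | succ p =>
      rw [evalList, show c _ = 0 from Function.update_of_ne (by simp) _ _]
      simp
  have key := mem_productImage_contract M hM h c hcF hTc
  -- Contraction with a column of linear forms produces coefficients without constant term.
  have hle : productImage (fun i => contract (A := A) (M.col i)) (degreeGE A (Fin v → A)) 1 d ⊔
      valuesIn _ ⊥ ≤
      ({ carrier := {c | ∀ S, c d (b ∘ ofFinEmbEquiv.symm S) ∈ RingHom.ker (constantCoeff (R := K))}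
         add_mem' := fun h h' S => add_mem (h S) (h' S)
         zero_mem' := fun S => zero_mem _
         smul_mem' := fun r c h S => Ideal.mul_mem_left _ r (h S) } :
        Submodule A (AlternatingForms A (Fin v → A))) := by
    refine sup_le (productImage_le fun l hl x hx S => ?_) fun x hx S => ?_
    · obtain ⟨i, rfl⟩ := List.length_eq_one_iff.mp hl
      simp only [List.map_cons, List.map_nil, List.prod_cons, List.prod_nil, mul_one,
        contract_apply]
      refine apply_vecCons_mem _ _ (fun j => ?_) _
      rw [RingHom.mem_ker, constantCoeff_eq]
      exact (hM₁ j i).coeff_eq_zero (by simp)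
    · have := hx d (b ∘ ofFinEmbEquiv.symm S)
      rw [Ideal.mem_bot] at this
      rw [this]
      exact zero_mem _
  have := hle key S₀
  rw [hcd, hγS, RingHom.mem_ker, constantCoeff_C] at this
  exact this

theorem finrank_homogeneousSubmodule_le (u d : ℕ) :
    Module.finrank K (homogeneousSubmodule (Fin u) K d) ≤ (u + d - 1).choose d := by
  classical
  have : homogeneousSubmodule (Fin u) K d ≤ Submodule.span K
      ((((Finset.univ : Finset (Fin u)).finsuppAntidiag d).image fun m => monomial m (1 : K) :
        Finset (MvPolynomial (Fin u) K)) : Set (MvPolynomial (Fin u) K)) := by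
    intro f hf
    rw [f.as_sum]
    refine Submodule.sum_mem _ fun m hm => ?_
    have h1 : monomial m (coeff m f) = coeff m f • monomial m (1 : K) := by
      rw [smul_monomial, smul_eq_mul, mul_one]
    rw [h1]
    refine Submodule.smul_mem _ _ (Submodule.subset_span ?_)
    rw [Finset.coe_image]
    refine ⟨m, ?_, rfl⟩
    have := hf (mem_support_iff.mp hm)
    rw [Finset.mem_coe, Finset.mem_finsuppAntidiag]
    refine ⟨?_, Finset.subset_univ _⟩
    rw [← this, Finsupp.weight_apply, Finsupp.sum_fintype _ _ (by simp)]
    simp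
  refine (Submodule.finrank_mono this).trans ((finrank_span_finset_le_card _).trans
    (Finset.card_image_le.trans ?_))
  rw [Finset.card_finsuppAntidiag_nat_eq_choose, Finset.card_univ, Fintype.card_fin]

theorem isHomogeneous_det {σ R : Type*} [CommRing R] {n : ℕ}
    (M : Matrix (Fin n) (Fin n) (MvPolynomial σ R)) (hM : ∀ i j, (M i j).IsHomogeneous 1) :
    M.det.IsHomogeneous n := by
  rw [Matrix.det_apply]
  refine IsHomogeneous.sum _ _ _ fun σ _ => ?_
  have := IsHomogeneous.prod Finset.univ (fun i => M (σ i) i) (fun _ => 1) fun i _ => hM _ _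
  rw [Units.smul_def]
  refine zsmul_mem (K := homogeneousSubmodule _ _ n) ?_ _
  simpa using this

theorem homogeneousSubmodule_le_span_maximal_minors [IsAlgClosed K] {u v d : ℕ}
    (M : Matrix (Fin v) (Fin d) (MvPolynomial (Fin u) K))
    (hM₁ : ∀ i j, (M i j).IsHomogeneous 1)
    (hM : ∀ x : Fin u → K, x ≠ 0 → Function.Injective (M.map (eval x)).mulVec)
    (h : v + 1 = d + u) :
    homogeneousSubmodule (Fin u) K d ≤
      Submodule.span K (Set.range fun r : Fin d → Fin v => (M.submatrix r id).det) := by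
  have hli := linearIndependent_maximal_minors M hM₁ hM h.le
  have hle : Submodule.span K (Set.range fun S : Set.powersetCard (Fin v) d =>
      (M.submatrix (Set.powersetCard.ofFinEmbEquiv.symm S) id).det) ≤
      homogeneousSubmodule (Fin u) K d := by
    rw [Submodule.span_le]
    rintro _ ⟨S, rfl⟩
    exact isHomogeneous_det _ fun i j => hM₁ _ _
  have : Module.Finite K (homogeneousSubmodule (Fin u) K d) :=
    Module.Finite.iff_fg.mpr (homogeneousSubmodule_fg _ _ _)
  -- The count: there are `v.choose d` independent minors, and `v = u + d - 1`.
  have heq := Submodule.eq_of_le_of_finrank_le hle (by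
    rw [finrank_span_eq_card hli, ← Nat.card_eq_fintype_card, Set.powersetCard.card,
      Nat.card_eq_fintype_card, Fintype.card_fin]
    refine (finrank_homogeneousSubmodule_le u d).trans (le_of_eq ?_)
    congr 1
    omega)
  rw [← heq]
  refine Submodule.span_mono ?_
  rintro _ ⟨S, rfl⟩
  exact ⟨_, rfl⟩

end MvPolynomial

/-! ### Bilinear maps and reduction to the critical dimension -/

namespace MvPolynomial

variable {K : Type*} [Field K]

/-- The linear form with the given coefficients. -/
def ofCoeffs {R : Type*} [CommRing R] {u : ℕ} : (Fin u → R) →ₗ[R] MvPolynomial (Fin u) R :=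
  Fintype.linearCombination R X

theorem ofCoeffs_apply {R : Type*} [CommRing R] {u : ℕ} (a : Fin u → R) :
    ofCoeffs a = ∑ s, a s • (X s : MvPolynomial (Fin u) R) := rfl

theorem isHomogeneous_ofCoeffs {R : Type*} [CommRing R] {u : ℕ} (a : Fin u → R) :
    (ofCoeffs a).IsHomogeneous 1 := by
  rw [ofCoeffs_apply]
  exact Submodule.sum_mem (homogeneousSubmodule _ _ 1) fun s _ =>
    Submodule.smul_mem _ _ (isHomogeneous_X _ _)

section Bilinear

variable {V : Type*} [AddCommGroup V] [Module K V] {d u : ℕ}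

/-- The linear form on `Fin u → K` obtained by evaluating a bilinear map at a basis vector and
composing with a functional. -/
def bilinearEntry (B : (Fin d → K) →ₗ[K] (Fin u → K) →ₗ[K] V) (i : Fin d) :
    Module.Dual K V →ₗ[K] MvPolynomial (Fin u) K :=
  ofCoeffs ∘ₗ LinearMap.pi fun s => Module.Dual.eval K V (B (Pi.single i 1) (Pi.single s 1))

theorem bilinearEntry_apply (B : (Fin d → K) →ₗ[K] (Fin u → K) →ₗ[K] V) (i : Fin d)
    (l : Module.Dual K V) :
    bilinearEntry B i l = ofCoeffs fun s => l (B (Pi.single i 1) (Pi.single s 1)) := rfl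

theorem bilinear_eq_sum (B : (Fin d → K) →ₗ[K] (Fin u → K) →ₗ[K] V) (y : Fin d → K)
    (x : Fin u → K) :
    B y x = ∑ i, ∑ s, (y i * x s) • B (Pi.single i 1) (Pi.single s 1) := by
  have hy : y = ∑ i, y i • (Pi.single i 1 : Fin d → K) := by
    ext k; simp [Pi.single_apply]
  have hx : x = ∑ s, x s • (Pi.single s 1 : Fin u → K) := by
    ext k; simp [Pi.single_apply]
  conv_lhs => rw [hy, hx]
  simp only [map_sum, map_smul, LinearMap.sum_apply, LinearMap.smul_apply, Finset.smul_sum,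
    smul_smul]
  rw [Finset.sum_comm]
  simp only [mul_comm]

theorem sum_eval_bilinearEntry (B : (Fin d → K) →ₗ[K] (Fin u → K) →ₗ[K] V)
    (l : Module.Dual K V) (x : Fin u → K) (y : Fin d → K) :
    ∑ i, eval x (bilinearEntry B i l) * y i = l (B y x) := by
  rw [bilinear_eq_sum B y x]
  simp only [bilinearEntry_apply, ofCoeffs_apply, map_sum, smul_eval, eval_X, Finset.sum_mul,
    map_smul, smul_eq_mul]
  refine Finset.sum_congr rfl fun i _ => Finset.sum_congr rfl fun s _ => ?_
  ring

/-- The span of all maximal minors of a matrix of linear forms, in all choices of coordinates of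
the target. -/
def minorSpan (B : (Fin d → K) →ₗ[K] (Fin u → K) →ₗ[K] V) :
    Submodule K (MvPolynomial (Fin u) K) :=
  Submodule.span K (Set.range fun l : Fin d → Module.Dual K V =>
    (Matrix.of fun a i => bilinearEntry B i (l a)).det)

/-- Functionals on `V'` pull back along `f`. This permits passing to a quotient of `V` or to a
larger space. -/
theorem minorSpan_compr₂_le {V' : Type*} [AddCommGroup V'] [Module K V']
    (B : (Fin d → K) →ₗ[K] (Fin u → K) →ₗ[K] V) (f : V →ₗ[K] V') :
    minorSpan (B.compr₂ f) ≤ minorSpan B := by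
  refine Submodule.span_mono ?_
  rintro _ ⟨l, rfl⟩
  exact ⟨fun a => l a ∘ₗ f, rfl⟩

theorem homogeneousSubmodule_le_minorSpan_of_finrank_eq [IsAlgClosed K] [FiniteDimensional K V]
    (B : (Fin d → K) →ₗ[K] (Fin u → K) →ₗ[K] V)
    (hB : ∀ y x, y ≠ 0 → x ≠ 0 → B y x ≠ 0) (h : Module.finrank K V + 1 = d + u) :
    homogeneousSubmodule (Fin u) K d ≤ minorSpan B := by
  let b := Module.finBasis K V
  let M : Matrix (Fin (Module.finrank K V)) (Fin d) (MvPolynomial (Fin u) K) :=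
    Matrix.of fun l i => bilinearEntry B i (b.coord l)
  refine (homogeneousSubmodule_le_span_maximal_minors M
    (fun l i => isHomogeneous_ofCoeffs _) (fun x hx => ?_) h).trans (Submodule.span_mono ?_)
  · change Function.Injective (M.map (eval x)).mulVecLin
    rw [injective_iff_map_eq_zero]
    intro y hy
    by_contra hy0
    refine hB y x hy0 hx (b.ext_elem fun l => ?_)
    rw [map_zero, Finsupp.zero_apply, ← Module.Basis.coord_apply, ← sum_eval_bilinearEntry]
    exact congrFun hy l
  · rintro _ ⟨r, rfl⟩
    exact ⟨fun a => b.coord (r a), rfl⟩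

theorem homogeneousSubmodule_le_minorSpan_of_finrank_le [IsAlgClosed K] [FiniteDimensional K V]
    (B : (Fin d → K) →ₗ[K] (Fin u → K) →ₗ[K] V)
    (hB : ∀ y x, y ≠ 0 → x ≠ 0 → B y x ≠ 0) (h : Module.finrank K V + 1 ≤ d + u) :
    homogeneousSubmodule (Fin u) K d ≤ minorSpan B := by
  -- Padding with zero coordinates reaches the critical dimension without a proof that smaller
  -- dimensions are degenerate.
  refine (homogeneousSubmodule_le_minorSpan_of_finrank_eq
    (B.compr₂ (LinearMap.inl K V (Fin (d + u - (Module.finrank K V + 1)) → K)))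
    (fun y x hy hx h0 => hB y x hy hx ?_) ?_).trans (minorSpan_compr₂_le B _)
  · rw [LinearMap.compr₂_apply] at h0
    exact congrArg Prod.fst h0
  · rw [Module.finrank_prod, Module.finrank_fin_fun]
    omega

/-- A polynomial relation between the coordinates of a bilinear map on the affine chart where the
`i`-th coordinate of the first argument is one. -/
theorem exists_relation_on_chart {v : ℕ} (a : Fin v → Fin d → Fin u → K) (i : Fin d)
    (h : d + u ≤ v) :
    ∃ F : MvPolynomial (Fin v) K, F ≠ 0 ∧ ∀ (y : Fin d → K) (x : Fin u → K), y i = 1 →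
      eval (fun l => ∑ j, ∑ s, y j * x s * a l j s) F = 0 := by
  let Y : Fin d → MvPolynomial ({j : Fin d // j ≠ i} ⊕ Fin u) K := fun j =>
    if hj : j ≠ i then X (Sum.inl ⟨j, hj⟩) else 1
  let f : Fin v → MvPolynomial ({j : Fin d // j ≠ i} ⊕ Fin u) K := fun l =>
    ∑ j, ∑ s, Y j * X (Sum.inr s) * C (a l j s)
  -- The chart has `d - 1 + u` parameters, fewer than the `v` coordinate polynomials.
  have hf : ¬ AlgebraicIndependent K f := by
    intro hf
    have := hf.lift_cardinalMk_le_trdeg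
    rw [trdeg_of_isDomain] at this
    simp only [Cardinal.lift_natCast, Cardinal.mk_fintype, Fintype.card_sum,
      Fintype.card_fin, Nat.cast_le, Fintype.card_subtype_compl,
      Fintype.card_subtype_eq] at this
    have := i.pos
    omega
  rw [algebraicIndependent_iff] at hf
  push Not at hf
  obtain ⟨F, hF, hF0⟩ := hf
  refine ⟨F, hF0, fun y x hy => ?_⟩
  let z : {j : Fin d // j ≠ i} ⊕ Fin u → K := Sum.elim (fun j => y j) x
  have hz : (aeval z).comp (aeval f) =
      aeval (R := K) (fun l => ∑ j, ∑ s, y j * x s * a l j s) := by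
    ext l
    have hY : ∀ j, aeval (R := K) z (Y j) = y j := by
      intro j
      by_cases hj : j = i
      · simp [Y, hj, hy]
      · simp [Y, hj, z]
    simp only [f, AlgHom.comp_apply, aeval_X, map_sum, map_mul, hY, algHom_C]
    simp [z]
  rw [← coe_aeval_eq_eval]
  change aeval (R := K) _ F = 0
  rw [← hz, AlgHom.comp_apply, hF, map_zero]

/-- A point off the hypersurface given by the product of the chart relations is never hit:
bilinearity lets a nonzero coordinate of `y` be scaled to one at the expense of `x`. -/
theorem exists_forall_bilinear_ne [Infinite K] [FiniteDimensional K V]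
    (B : (Fin d → K) →ₗ[K] (Fin u → K) →ₗ[K] V) (h : d + u ≤ Module.finrank K V) :
    ∃ p : V, ∀ y x, y ≠ 0 → B y x ≠ p := by
  let b := Module.finBasis K V
  choose F hF0 hF using fun i => exists_relation_on_chart
    (fun l j s => b.coord l (B (Pi.single j 1) (Pi.single s 1))) i h
  have hprod : ∏ i, F i ≠ 0 := Finset.prod_ne_zero_iff.mpr fun i _ => hF0 i
  obtain ⟨z, hz⟩ : ∃ z, eval z (∏ i, F i) ≠ 0 := by
    by_contra! hz
    exact hprod (MvPolynomial.funext fun z => by rw [hz, map_zero])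
  refine ⟨∑ l, z l • b l, fun y x hy hyx => hz ?_⟩
  obtain ⟨i, hi⟩ := Function.ne_iff.mp hy
  rw [map_prod]
  refine Finset.prod_eq_zero (Finset.mem_univ i) ?_
  have hB : B ((y i)⁻¹ • y) (y i • x) = ∑ l, z l • b l := by
    rw [← hyx, map_smul, map_smul, LinearMap.smul_apply, smul_smul, mul_inv_cancel₀ hi, one_smul]
  rw [← hF i ((y i)⁻¹ • y) (y i • x) (by simpa using inv_mul_cancel₀ hi)]
  congr 2
  ext l
  have : b.coord l (B ((y i)⁻¹ • y) (y i • x)) = z l := by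
    rw [hB, map_sum]
    simp [Finsupp.single_apply]
  rw [← this, bilinear_eq_sum]
  simp

theorem homogeneousSubmodule_le_minorSpan_of_pos [IsAlgClosed K] (hd : 0 < d) (n : ℕ) :
    ∀ (V : Type*) [AddCommGroup V] [Module K V] [FiniteDimensional K V]
      (B : (Fin d → K) →ₗ[K] (Fin u → K) →ₗ[K] V),
      (∀ y x, y ≠ 0 → x ≠ 0 → B y x ≠ 0) → Module.finrank K V = n →
      homogeneousSubmodule (Fin u) K d ≤ minorSpan B := by
  induction n with
  | zero =>
    intro V _ _ _ B hB hn
    exact homogeneousSubmodule_le_minorSpan_of_finrank_le B hB (by omega)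
  | succ n ih =>
    intro V _ _ _ B hB hn
    rcases Nat.lt_or_ge (n + 1) (d + u) with hlt | hge
    · exact homogeneousSubmodule_le_minorSpan_of_finrank_le B hB (by omega)
    · have : Infinite K := IsAlgClosed.instInfinite
      obtain ⟨p, hp⟩ := exists_forall_bilinear_ne B (by omega)
      -- Zero is a value at a nonzero first argument; such an argument exists only for `d > 0`.
      have hp0 : p ≠ 0 := fun h0 => hp (Pi.single ⟨0, hd⟩ 1) 0
        (by simp) (by rw [map_zero, h0])
      refine (ih (V ⧸ Submodule.span K {p}) (B.compr₂ (Submodule.mkQ _)) ?_ ?_).trans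
        (minorSpan_compr₂_le B _)
      · intro y x hy hx h0
        rw [LinearMap.compr₂_apply, Submodule.mkQ_apply, Submodule.Quotient.mk_eq_zero,
          Submodule.mem_span_singleton] at h0
        obtain ⟨t, ht⟩ := h0
        have ht0 : t ≠ 0 := by
          rintro rfl
          exact hB y x hy hx (by rw [← ht, zero_smul])
        -- A nonzero value on the line through `p` could be rescaled to `p` itself.
        refine hp y (t⁻¹ • x) hy ?_
        rw [map_smul, ← ht, smul_smul, inv_mul_cancel₀ ht0, one_smul]
      · have := Submodule.finrank_quotient_add_finrank (Submodule.span K {p})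
        rw [finrank_span_singleton hp0] at this
        omega

/-- The maximal minors of a `1`-generic matrix of linear forms over an algebraically closed field
span all forms of the appropriate degree. -/
theorem homogeneousSubmodule_le_minorSpan [IsAlgClosed K] [FiniteDimensional K V]
    (B : (Fin d → K) →ₗ[K] (Fin u → K) →ₗ[K] V)
    (hB : ∀ y x, y ≠ 0 → x ≠ 0 → B y x ≠ 0) :
    homogeneousSubmodule (Fin u) K d ≤ minorSpan B := by
  rcases Nat.eq_zero_or_pos d with rfl | hd
  · intro f hf
    rw [mem_homogeneousSubmodule, ← totalDegree_zero_iff_isHomogeneous] at hf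
    rw [totalDegree_eq_zero_iff_eq_C.mp hf, ← mul_one (C _), ← smul_eq_C_mul]
    refine Submodule.smul_mem _ _ (Submodule.subset_span ⟨0, ?_⟩)
    simp
  · exact homogeneousSubmodule_le_minorSpan_of_pos hd _ V B hB rfl

end Bilinear

/-! ### Minors in coordinates and descent of the base field -/

/-- The matrix of linear forms with the given coefficients. -/
def linearMatrix {R J I : Type*} [CommRing R] {u : ℕ} (a : J → I → Fin u → R) :
    Matrix J I (MvPolynomial (Fin u) R) :=
  Matrix.of fun j i => ofCoeffs (a j i)

theorem map_linearMatrix {R S J I : Type*} [CommRing R] [CommRing S] (f : R →+* S) {u : ℕ}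
    (a : J → I → Fin u → R) :
    (linearMatrix a).map (map f) = linearMatrix fun j i s => f (a j i s) := by
  ext1 j i
  simp [linearMatrix, ofCoeffs_apply, smul_eq_C_mul]

theorem homogeneousSubmodule_le_span_minors [IsAlgClosed K] {J : Type*} [Fintype J]
    [DecidableEq J] {d u : ℕ} (a : J → Fin d → Fin u → K)
    (ha : ∀ (y : Fin d → K) (x : Fin u → K), y ≠ 0 → x ≠ 0 → ∃ j, ∑ i, ∑ s, y i * x s * a j i s ≠ 0) :
    homogeneousSubmodule (Fin u) K d ≤ Submodule.span K
      (Set.range fun r : Fin d ↪ J => ((linearMatrix a).submatrix r id).det) := by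
  let B : (Fin d → K) →ₗ[K] (Fin u → K) →ₗ[K] (J → K) :=
    LinearMap.mk₂ K (fun y x j => ∑ i, ∑ s, y i * x s * a j i s)
      (fun y y' x => by ext j; simp [add_mul, Finset.sum_add_distrib])
      (fun c y x => by ext j; simp [Finset.mul_sum, mul_assoc])
      (fun y x x' => by ext j; simp [mul_add, add_mul, Finset.sum_add_distrib])
      (fun c y x => by ext j; simp [Finset.mul_sum, mul_assoc, mul_left_comm])
  have hB : ∀ j i, bilinearEntry B i (LinearMap.proj j) = ofCoeffs (a j i) := by
    intro j i
    rw [bilinearEntry_apply]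
    congr 1
    ext s
    simp [B, Pi.single_apply]
  refine (homogeneousSubmodule_le_minorSpan B fun y x hy hx h0 => ?_).trans ?_
  · obtain ⟨j, hj⟩ := ha y x hy hx
    exact hj (congrFun h0 j)
  · set Q := Submodule.span K
      (Set.range fun r : Fin d ↪ J => ((linearMatrix a).submatrix r id).det) with hQ
    let D : MultilinearMap K (fun _ : Fin d => Module.Dual K (J → K)) (MvPolynomial (Fin u) K) :=
      ((Matrix.detRowAlternating (n := Fin d)
        (R := MvPolynomial (Fin u) K)).toMultilinearMap.restrictScalars K).compLinearMap
        fun _ => LinearMap.pi fun i => bilinearEntry B i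
    -- Determinants are multilinear in the functionals, so the dual basis suffices; a repeated
    -- coordinate gives two equal rows.
    have hD : Q.mkQ.compMultilinearMap D = 0 := by
      refine Module.Basis.ext_multilinear (fun _ => (Pi.basisFun K J).dualBasis) fun r => ?_
      have hrow : ∀ c i, bilinearEntry B i ((Pi.basisFun K J).dualBasis (r c)) =
          linearMatrix a (r c) i := by
        intro c i
        rw [linearMatrix, Matrix.of_apply, ← hB]
        congr 1
        ext
        simp
      have hdet : D (fun c => (Pi.basisFun K J).dualBasis (r c)) =
          ((linearMatrix a).submatrix r id).det := by
        change Matrix.det _ = _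
        congr 1
        ext1 c i
        exact hrow c i
      rw [LinearMap.compMultilinearMap_apply, hdet, _root_.zero_apply, Submodule.mkQ_apply,
        Submodule.Quotient.mk_eq_zero]
      by_cases hr : Function.Injective r
      · exact Submodule.subset_span ⟨⟨r, hr⟩, rfl⟩
      · obtain ⟨c, c', hcc, hne⟩ := Function.not_injective_iff.mp hr
        rw [Matrix.det_zero_of_row_eq hne]
        · exact zero_mem _
        · ext1 i
          simp [hcc]
    refine Submodule.span_le.mpr ?_
    rintro _ ⟨l, rfl⟩
    have := congrArg (fun D => D l) hD
    exact (Submodule.Quotient.mk_eq_zero Q).mp this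

/-- Whether a set of polynomials spans all forms of some degree can be tested over an extension
field. -/
theorem homogeneousSubmodule_le_span_of_map {k σ : Type*} [Field k] [Algebra k K] {d : ℕ}
    {S : Set (MvPolynomial σ k)}
    (h : homogeneousSubmodule σ K d ≤ Submodule.span K (map (algebraMap k K) '' S)) :
    homogeneousSubmodule σ k d ≤ Submodule.span k S := by
  intro f hf
  by_contra hfS
  -- A functional separating `f` from the span is extended to `K` through its values on monomials.
  obtain ⟨φ, hφf, hφS⟩ := Submodule.exists_le_ker_of_notMem hfS
  let φK : MvPolynomial σ K →ₗ[K] K :=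
    (basisMonomials σ K).constr K fun m => algebraMap k K (φ (monomial m 1))
  have hφK : ∀ g, φK (map (algebraMap k K) g) = algebraMap k K (φ g) := by
    intro g
    induction g using MvPolynomial.induction_on' with
    | monomial m c =>
      have h1 : (monomial m (algebraMap k K c) : MvPolynomial σ K) =
          algebraMap k K c • basisMonomials σ K m := by
        rw [coe_basisMonomials, smul_monomial, smul_eq_mul, mul_one]
      have h2 : (monomial m c : MvPolynomial σ k) = c • monomial m 1 := by
        rw [smul_monomial, smul_eq_mul, mul_one]
      rw [map_monomial, h1, map_smul, Module.Basis.constr_basis, h2, map_smul, smul_eq_mul,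
        smul_eq_mul, map_mul]
    | add p q hp hq => simp only [map_add, hp, hq]
  have hker : Submodule.span K (map (algebraMap k K) '' S) ≤ LinearMap.ker φK := by
    rw [Submodule.span_le]
    rintro _ ⟨g, hg, rfl⟩
    rw [SetLike.mem_coe, LinearMap.mem_ker, hφK,
      LinearMap.mem_ker.mp (hφS (Submodule.subset_span hg)), map_zero]
  have := hker (h (IsHomogeneous.map (mem_homogeneousSubmodule _ _ |>.mp hf) (algebraMap k K)))
  rw [LinearMap.mem_ker, hφK, map_eq_zero] at this
  exact hφf this

end MvPolynomial

/-! ### Translation from pairings and `Sym(U^*)` to matrices of linear forms -/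

namespace Pairing

variable {k W U V : Type*} [Field k]
  [AddCommGroup W] [Module k W] [AddCommGroup U] [Module k U] [AddCommGroup V] [Module k V]

theorem baseChange_repr_rTensor_ι [FiniteDimensional k U] {J : Type*} (bV : Module.Basis J k V)
    (f : U →ₗ[k] V) (j : J) :
    (bV.baseChange (SymDual k U)).repr ((SymmetricAlgebra.ι k (Module.Dual k U)).rTensor V
      ((dualTensorHomEquiv k U V).symm f)) j =
      SymmetricAlgebra.ι k (Module.Dual k U) (bV.coord j ∘ₗ f) := by
  obtain ⟨t, rfl⟩ := (dualTensorHomEquiv k U V).surjective f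
  rw [LinearEquiv.symm_apply_apply]
  induction t with
  | zero => simp
  | tmul φ v =>
    rw [LinearMap.rTensor_tmul, Module.Basis.baseChange_repr_tmul, ← map_smul]
    congr 1
    ext x
    simp [mul_comm]
  | add t t' ht ht' =>
    simp only [map_add, Finsupp.add_apply, ht, ht', LinearMap.comp_add]

theorem toMatrix_associatedMap [FiniteDimensional k U] {I J : Type*} [Fintype I] [DecidableEq I]
    [Fintype J] (μ : W ⊗[k] U →ₗ[k] V) (bW : Module.Basis I k W) (bV : Module.Basis J k V)
    (j : J) (i : I) :
    LinearMap.toMatrix (bW.baseChange (SymDual k U)) (bV.baseChange (SymDual k U))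
      (associatedMap μ) j i =
      SymmetricAlgebra.ι k (Module.Dual k U) (bV.coord j ∘ₗ TensorProduct.curry μ (bW i)) := by
  rw [LinearMap.toMatrix_apply, Module.Basis.baseChange_apply, associatedMap,
    LinearMap.liftBaseChange_tmul, one_smul, ← baseChange_repr_rTensor_ι]
  rfl

theorem equivMvPolynomial_dualBasis_ι {u : ℕ} (bU : Module.Basis (Fin u) k U)
    (φ : Module.Dual k U) :
    SymmetricAlgebra.equivMvPolynomial bU.dualBasis
      (SymmetricAlgebra.ι k (Module.Dual k U) φ) = MvPolynomial.ofCoeffs fun s => φ (bU s) := by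
  have hφ : φ = ∑ s, φ (bU s) • bU.dualBasis s := by
    refine bU.ext fun t => ?_
    simp
  conv_lhs => rw [hφ]
  simp only [map_sum, map_smul, SymmetricAlgebra.equivMvPolynomial_ι_apply,
    MvPolynomial.ofCoeffs_apply]

theorem map_symDualPiece {u : ℕ} (bU : Module.Basis (Fin u) k U) (d : ℕ) :
    (symDualPiece k U d).map
      (SymmetricAlgebra.equivMvPolynomial bU.dualBasis).toAlgHom.toLinearMap =
      MvPolynomial.homogeneousSubmodule (Fin u) k d := by
  rw [symDualPiece, Submodule.map_pow, ← MvPolynomial.homogeneousSubmodule_one_pow]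
  congr 1
  rw [MvPolynomial.homogeneousSubmodule_one_eq_span_X, ← LinearMap.range_comp,
    ← Submodule.map_top, ← bU.dualBasis.span_eq, Submodule.map_span, ← Set.range_comp]
  congr 2
  ext1 s
  exact SymmetricAlgebra.equivMvPolynomial_ι_apply _ s

theorem exists_coord_sum_ne_zero {I J : Type*} [Fintype I] [Fintype J] {u : ℕ}
    (μ : W ⊗[k] U →ₗ[k] V) (hμ : IsGeometricallyOneGeneric μ)
    (bW : Module.Basis I k W) (bU : Module.Basis (Fin u) k U) (bV : Module.Basis J k V)
    (y : I → AlgebraicClosure k) (x : Fin u → AlgebraicClosure k) (hy : y ≠ 0) (hx : x ≠ 0) :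
    ∃ j, ∑ i, ∑ s, y i * x s *
      algebraMap k (AlgebraicClosure k) (bV.coord j (μ (bW i ⊗ₜ bU s))) ≠ 0 := by
  let L := AlgebraicClosure k
  by_contra! h
  refine hμ (∑ i, y i ⊗ₜ[k] bW i) (∑ s, x s ⊗ₜ[k] bU s) (fun h0 => hy ?_) (fun h0 => hx ?_) ?_
  · ext i
    have := congrArg (fun w => (bW.baseChange L).repr w i) h0
    simpa [Module.Basis.baseChange_repr_tmul, Finsupp.single_apply, L] using this
  · ext i
    have := congrArg (fun w => (bU.baseChange L).repr w i) h0
    simpa [Module.Basis.baseChange_repr_tmul, Finsupp.single_apply, L] using this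
  · refine (bV.baseChange L).ext_elem fun j => ?_
    rw [map_zero, Finsupp.zero_apply, ← h j, TensorProduct.sum_tmul]
    simp only [TensorProduct.tmul_sum, map_sum, extendScalars, LinearMap.comp_apply,
      LinearEquiv.coe_coe, TensorProduct.AlgebraTensorModule.distribBaseChange_symm_tmul,
      LinearMap.baseChange_tmul, Finsupp.coe_finsetSum, Finset.sum_apply,
      Module.Basis.baseChange_repr_tmul, Algebra.smul_def, Module.Basis.coord_apply]
    refine Finset.sum_congr rfl fun i _ => Finset.sum_congr rfl fun s _ => mul_comm _ _

end Pairing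

end

theorem lemma3p2 {k W U V : Type*} [Field k]
    [AddCommGroup W] [Module k W] [FiniteDimensional k W]
    [AddCommGroup U] [Module k U] [FiniteDimensional k U]
    [AddCommGroup V] [Module k V] [FiniteDimensional k V]
    (μ : W ⊗[k] U →ₗ[k] V) (hμ : Pairing.IsGeometricallyOneGeneric μ)
    (d : ℕ) (hd : d ≤ Module.finrank k W)
    {I J : Type*} [Fintype I] [DecidableEq I] [Fintype J] [DecidableEq J]
    (bW : Module.Basis I k W) (bV : Module.Basis J k V) :
    Submodule.span k
        (Pairing.minors
          (LinearMap.toMatrix (bW.baseChange (Pairing.SymDual k U))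
            (bV.baseChange (Pairing.SymDual k U)) (Pairing.associatedMap μ)) d) =
      Pairing.symDualPiece k U d := by
  let bU := Module.finBasis k U
  let e := SymmetricAlgebra.equivMvPolynomial bU.dualBasis
  let a : J → I → Fin (Module.finrank k U) → k := fun j i s => bV.coord j (μ (bW i ⊗ₜ bU s))
  have he : ∀ {m : ℕ} (r : Fin m → J) (c : Fin m → I),
      e (((LinearMap.toMatrix (bW.baseChange (Pairing.SymDual k U))
        (bV.baseChange (Pairing.SymDual k U)) (Pairing.associatedMap μ)).submatrix r c).det) =
      ((MvPolynomial.linearMatrix a).submatrix r c).det := by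
    intro m r c
    rw [AlgEquiv.map_det]
    congr 1
    ext1 i j
    simp only [AlgEquiv.mapMatrix_apply, Matrix.map_apply, Matrix.submatrix_apply,
      Pairing.toMatrix_associatedMap, e, Pairing.equivMvPolynomial_dualBasis_ι]
    rfl
  apply Submodule.map_injective_of_injective (f := e.toAlgHom.toLinearMap) e.injective
  rw [Pairing.map_symDualPiece bU, Submodule.map_span]
  refine le_antisymm (Submodule.span_le.mpr ?_) ?_
  · rintro _ ⟨_, ⟨r, c, rfl⟩, rfl⟩
    change e _ ∈ _
    rw [he]
    exact MvPolynomial.isHomogeneous_det _ fun i j => MvPolynomial.isHomogeneous_ofCoeffs _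
  -- Since `d ≤ dim W`, one can fix `d` columns; their minors alone span.
  · obtain ⟨c⟩ : Nonempty (Fin d ↪ I) := Function.Embedding.nonempty_of_card_le (by
      rwa [Fintype.card_fin, ← Module.finrank_eq_card_basis bW])
    refine MvPolynomial.homogeneousSubmodule_le_span_of_map (K := AlgebraicClosure k)
      ((MvPolynomial.homogeneousSubmodule_le_span_minors
        (fun j i s => algebraMap k (AlgebraicClosure k) (a j (c i) s)) ?_).trans
        (Submodule.span_mono ?_))
    · intro y x hy hx
      -- 1-genericity passes to the chosen columns by extending `y` by zero.
      obtain ⟨j, hj⟩ := Pairing.exists_coord_sum_ne_zero μ hμ bW bU bV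
        (Function.extend c y 0) x (fun h0 => hy (by
          ext i
          rw [← c.injective.extend_apply y 0 i, h0]
          rfl)) hx
      refine ⟨j, fun h0 => hj ?_⟩
      rw [← h0, ← Finset.sum_subset (Finset.subset_univ (Finset.univ.map c)), Finset.sum_map]
      · simp only [c.injective.extend_apply]
        rfl
      · intro i _ hi
        have : ¬ ∃ i', c i' = i := by simpa using hi
        simp [Function.extend_apply' _ _ _ this]
    · rintro _ ⟨r, rfl⟩
      refine ⟨_, ⟨_, ⟨r, c, rfl⟩, rfl⟩, ?_⟩
      change MvPolynomial.map (algebraMap k (AlgebraicClosure k)) (e _) = _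
      rw [he, RingHom.map_det, RingHom.mapMatrix_apply]
      change Matrix.det (((MvPolynomial.linearMatrix a).map
        (MvPolynomial.map (algebraMap k (AlgebraicClosure k)))).submatrix r c) = _
      rw [MvPolynomial.map_linearMatrix]
      rfl
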